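/- Fix a non-empty set $\mathscr{O}$ of type atoms and a countably infinite set $\mathscr{V}$ of term variables. The types of system $\mathscr{R}$ are defined coinductively by $$\sigma,\tau ::= o\in\mathscr{O}\ \mid\ [\sigma_i]_{i\in I}\to\tau ,$$ where $I$ is countable (possibly empty or infinite) and $[\sigma_i]_{i\in I}$ is a multiset of types, in which multiplicities may be infinite. A context $\Gamma$ is a total function from $\mathscr{V}$ to multisets of types; its domain is $\{x \mid \Gamma(x)\neq[\,]\}$, and sums of contexts (multiset sums) are taken pointwise. We write $x:m$ for the context that maps $x$ to $m$ and every other variable to $[\,]$. Derivations are defined inductively (with possibly countably many premises) by the three rules $$\frac{}{x:[\tau]\vdash x:\tau}\qquad \frac{\Gamma;\,x:[\sigma_i]_{i\in I}\vdash t:\tau}{\Gamma\vdash\lambda x.t:[\sigma_i]_{i\in I}\to\tau}\ (x\notin\mathrm{dom}\,\Gamma)\qquad \frac{\Gamma\vdash t:[\sigma_i]_{i\in I}\to\tau\qquad(\Delta_i\vdash u:\sigma_i)_{i\in I}}{\Gamma+\sum_{i\in I}\Delta_i\vdash t\,u:\tau}$$ on pure, finite $\lambda$-terms (variables, abstractions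 and applications). **Theorem.** Every $\lambda$-term $t$ is typable in system $\mathscr{R}$: there are a context $\Gamma$ and a type $\tau$ such that $\Gamma\vdash t:\tau$ is derivable. Equivalently, the denotation of $t$ in the infinitary relational model, that is, the set of its derivable judgments $\{(\Gamma,\tau)\mid \Gamma\vdash t:\tau \text{ is derivable in } \mathscr{R}\}$, is non-empty. -/

import Mathlib

/-! ### Countable multisets -/

/-- Two families indexed by sets of natural numbers present the same multiset when they agree up to
a bijection of their index sets. -/
def familySetoid (α : Type) : Setoid (Σ K : Set ℕ, K → α) where
  r f g := ∃ e : f.1 ≃ g.1, ∀ k, f.2 k = g.2 (e k)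
  iseqv :=
    { refl := fun f => ⟨Equiv.refl _, fun _ => rfl⟩
      symm := fun ⟨e, h⟩ => ⟨e.symm, fun k => by rw [h, Equiv.apply_symm_apply]⟩
      trans := fun ⟨e, h⟩ ⟨e', h'⟩ => ⟨e.trans e', fun k => by rw [h, h']; rfl⟩ }

/-- Countable (finite or countably infinite) multisets of elements of `α`: families indexed by a
set of natural numbers, up to reindexing. An element may have infinite multiplicity. -/
def CMultiset (α : Type) : Type := Quotient (familySetoid α)

namespace CMultiset

variable {α β : Type}

/-- The multiset `[a_i]_{i ∈ ι}` of a family indexed by a countable type. -/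
noncomputable def ofFamily {ι : Type} [Countable ι] (a : ι → α) : CMultiset α :=
  Quotient.mk (familySetoid α) ⟨Set.range (exists_injective_nat ι).choose,
    fun k => a ((Equiv.ofInjective _ (exists_injective_nat ι).choose_spec).symm k)⟩

theorem ofFamily_eq_ofFamily_iff {ι κ : Type} [Countable ι] [Countable κ] (a : ι → α) (b : κ → α) :
    ofFamily a = ofFamily b ↔ ∃ e : ι ≃ κ, ∀ i, a i = b (e i) := by
  refine (Quotient.eq (r := familySetoid α)).trans ?_
  constructor
  · rintro ⟨e, h⟩
    refine ⟨((Equiv.ofInjective _ (exists_injective_nat ι).choose_spec).trans e).trans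
      (Equiv.ofInjective _ (exists_injective_nat κ).choose_spec).symm, fun i => ?_⟩
    simpa using h (Equiv.ofInjective _ (exists_injective_nat ι).choose_spec i)
  · rintro ⟨e, h⟩
    refine ⟨((Equiv.ofInjective _ (exists_injective_nat ι).choose_spec).symm.trans e).trans
      (Equiv.ofInjective _ (exists_injective_nat κ).choose_spec), fun i => ?_⟩
    simp [h]

theorem mk_eq_ofFamily (f : Σ K : Set ℕ, K → α) :
    Quotient.mk (familySetoid α) f = ofFamily f.2 := by
  unfold ofFamily
  exact Quotient.sound ⟨Equiv.ofInjective _ (exists_injective_nat f.1).choose_spec,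
    fun k => by simp⟩

/-- The family chosen to present a multiset. -/
noncomputable def out (m : CMultiset α) : Σ K : Set ℕ, K → α := Quotient.out m

theorem ofFamily_out (m : CMultiset α) : ofFamily m.out.2 = m := by
  rw [← mk_eq_ofFamily]
  exact Quotient.out_eq m

/-- The image of a multiset under a map. -/
def map (g : α → β) (m : CMultiset α) : CMultiset β :=
  Quotient.map' (s₁ := familySetoid α) (s₂ := familySetoid β) (fun f => ⟨f.1, fun k => g (f.2 k)⟩)
    (fun _ _ ⟨e, h⟩ => ⟨e, fun k => congrArg g (h k)⟩) m

theorem map_ofFamily {ι : Type} [Countable ι] (g : α → β) (a : ι → α) :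
    map g (ofFamily a) = ofFamily (fun i => g (a i)) := rfl

/-- The empty multiset `[ ]`. -/
noncomputable instance : Zero (CMultiset α) := ⟨ofFamily (fun e : Empty => e.elim)⟩

/-- The one-element multiset `[a]`. -/
noncomputable def single (a : α) : CMultiset α := ofFamily (fun _ : Unit => a)

/-- The multiset sum (juxtaposition) of a countable family of multisets. -/
noncomputable def sum {ι : Type} [Countable ι] (m : ι → CMultiset α) : CMultiset α :=
  ofFamily (fun p : Σ i, (m i).out.1 => (m p.1).out.2 p.2)

theorem sum_ofFamily {ι : Type} [Countable ι] {κ : ι → Type} [∀ i, Countable (κ i)]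
    (a : ∀ i, κ i → α) :
    sum (fun i => ofFamily (a i)) = ofFamily (fun p : Σ i, κ i => a p.1 p.2) := by
  have h : ∀ i, ∃ e : (ofFamily (a i)).out.1 ≃ κ i, ∀ k, (ofFamily (a i)).out.2 k = a i (e k) :=
    fun i => (ofFamily_eq_ofFamily_iff _ _).1 (ofFamily_out _)
  choose e he using h
  exact (ofFamily_eq_ofFamily_iff _ _).2 ⟨Equiv.sigmaCongrRight e, fun p => he p.1 p.2⟩

/-- The sum of two multisets. -/
noncomputable instance : Add (CMultiset α) :=
  ⟨fun m n => ofFamily (Sum.elim m.out.2 n.out.2)⟩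

theorem ofFamily_add_ofFamily {ι κ : Type} [Countable ι] [Countable κ] (a : ι → α) (b : κ → α) :
    ofFamily a + ofFamily b = ofFamily (Sum.elim a b) := by
  obtain ⟨e, he⟩ := (ofFamily_eq_ofFamily_iff _ _).1 (ofFamily_out (ofFamily a))
  obtain ⟨e', he'⟩ := (ofFamily_eq_ofFamily_iff _ _).1 (ofFamily_out (ofFamily b))
  refine (ofFamily_eq_ofFamily_iff _ _).2 ⟨Equiv.sumCongr e e', fun p => ?_⟩
  rcases p with p | p
  · exact he p
  · exact he' p

end CMultiset

/-! ### Types -/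

/-- One layer of the grammar `σ, τ ::= o ∈ O | [σ_i]_{i ∈ I} → τ`: an atom, or a pair formed of a
countable multiset and a target. -/
def RTypeF (O X : Type) : Type := O ⊕ (CMultiset X × X)

/-- `RTypeF O` is a functor, presented as a quotient of the polynomial functor that has one nullary
shape for each atom and, for each index set `K ⊆ ℕ`, one shape with `K`-many sources
and one target (`none`). -/
noncomputable instance (O : Type) : QPF (RTypeF O) where
  map g x := Sum.map id (Prod.map (CMultiset.map g) g) x
  P := ⟨O ⊕ Set ℕ, Sum.elim (fun _ => Empty) (fun K => Option K)⟩
  abs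
    | ⟨Sum.inl o, _⟩ => Sum.inl o
    | ⟨Sum.inr K, f⟩ => Sum.inr (Quotient.mk (familySetoid _) ⟨K, fun k => f (some k)⟩, f none)
  repr
    | Sum.inl o => ⟨Sum.inl o, fun e : Empty => e.elim⟩
    | Sum.inr (m, t) => ⟨Sum.inr m.out.1, fun k : Option m.out.1 => k.elim t m.out.2⟩
  abs_repr x := by
    rcases x with o | ⟨m, t⟩
    · rfl
    · exact congrArg (fun n => Sum.inr (n, t)) (Quotient.out_eq m)
  abs_map g p := by
    obtain ⟨o | K, f⟩ := p <;> rfl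

/-- The set of types over the atoms `O`, coinductively defined by
`σ, τ ::= o ∈ O | [σ_i]_{i ∈ I} → τ` with `I` countable: the final coalgebra of one layer
of the grammar. -/
def RType (O : Type) : Type := QPF.Cofix (RTypeF O)

namespace RType

variable {O : Type}

/-- The top layer of a type. -/
noncomputable def dest (σ : RType O) : RTypeF O (RType O) := QPF.Cofix.dest σ

/-- The type with a given top layer. -/
noncomputable def mk (x : RTypeF O (RType O)) : RType O :=
  QPF.Cofix.corec (Functor.map dest : RTypeF O (RType O) → RTypeF O (RTypeF O (RType O))) x

theorem mk_dest (σ : RType O) : mk (dest σ) = σ := by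
  refine QPF.Cofix.bisim_rel (fun x y : RType O => x = mk (dest y)) ?_ _ _ rfl
  rintro x y rfl
  change _ <$> QPF.Cofix.dest (QPF.Cofix.corec _ _) = _
  rw [QPF.Cofix.dest_corec, ← QPF.comp_map, ← QPF.comp_map]
  congr 1
  funext z
  exact Quot.sound rfl

theorem dest_mk (x : RTypeF O (RType O)) : dest (mk x) = x := by
  have h : (mk ∘ dest : RType O → RType O) = id := funext mk_dest
  change QPF.Cofix.dest (QPF.Cofix.corec _ _) = _
  rw [QPF.Cofix.dest_corec, ← QPF.comp_map]
  exact (congrArg (fun g : RType O → RType O => g <$> x) h).trans (QPF.id_map x)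

/-- The atomic type `o`. -/
noncomputable def atom (o : O) : RType O := mk (Sum.inl o)

/-- The arrow type `m → τ`, with a multiset `m` of types as its source. -/
noncomputable def arrow (m : CMultiset (RType O)) (τ : RType O) : RType O := mk (Sum.inr (m, τ))

end RType

/-! ### Terms, contexts and derivations -/

/-- Pure `λ`-terms, with variables named by natural numbers. -/
inductive Term : Type
  | var (x : ℕ) : Term
  | lam (x : ℕ) (t : Term) : Term
  | app (t u : Term) : Term

/-- Contexts: total functions from variables to multisets of types. -/
def RContext (O : Type) : Type := ℕ → CMultiset (RType O)

/-- The context `x : m`, empty on all variables other than `x`. -/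
noncomputable def RContext.single {O : Type} (x : ℕ) (m : CMultiset (RType O)) : RContext O :=
  Function.update (fun _ => 0) x m

/-- `RDerivable Γ t τ`: the judgment `Γ ⊢ t : τ` is the conclusion of a derivation. Derivations are
inductive objects; only the types are coinductive, and an application rule may have countably
many argument premises. -/
inductive RDerivable {O : Type} : RContext O → Term → RType O → Prop
  /-- `x : [τ] ⊢ x : τ` -/
  | ax (x : ℕ) (τ : RType O) :
      RDerivable (RContext.single x (CMultiset.single τ)) (Term.var x) τ
  /-- from `Γ; x : m ⊢ t : τ` infer `Γ ⊢ λx.t : m → τ`, where `x` is not in the domain of `Γ` -/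
  | abs (Γ : RContext O) (x : ℕ) (m : CMultiset (RType O)) (t : Term) (τ : RType O)
      (hx : Γ x = 0) (ht : RDerivable (Function.update Γ x m) t τ) :
      RDerivable Γ (Term.lam x t) (RType.arrow m τ)
  /-- from `Γ ⊢ t : [σ_i]_{i ∈ I} → τ` and `Δ_i ⊢ u : σ_i` for all `i ∈ I` infer
  `Γ + Σ_{i ∈ I} Δ_i ⊢ t u : τ` -/
  | app {I : Type} [Countable I] (Γ : RContext O) (Δ : I → RContext O) (t u : Term)
      (σ : I → RType O) (τ : RType O)
      (ht : RDerivable Γ t (RType.arrow (CMultiset.ofFamily σ) τ))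
      (hu : ∀ i, RDerivable (Δ i) u (σ i)) :
      RDerivable (fun x => Γ x + CMultiset.sum (fun i => Δ i x)) (Term.app t u) τ

/-- A term is typable if some judgment about it is derivable. -/
def RTypable (O : Type) (t : Term) : Prop := ∃ (Γ : RContext O) (τ : RType O), RDerivable Γ t τ

/-- The denotation of a term in the infinitary relational model: the set of its derivable
judgments. -/
def denotation (O : Type) (t : Term) : Set (RContext O × RType O) :=
  {p | RDerivable p.1 t p.2}

/-! No normalisation is needed: a type can be read off any run of a Krivine machine, even an endless
one. The term is run on an infinite stack of distinct external arguments. A state is typed by its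
stack `s` (`stackType`): the first source has one element for each time at which the closure `s 0`
is looked up, namely the type of the stack at that time. Coinductive types and infinite
multiplicities make this always meaningful. The derivation itself is inductive because it follows
the structure of the term; an argument is typed once per lookup, possibly never or infinitely often.

It remains to match multisets. For an abstraction, the lookups of the closure bound to `x` must be
exactly the occurrences of `x` in the body (`occ_eq_lookups`); this holds because timestamps keep
closures distinct and each is popped at most once (`PoppedAt.time_unique`). For an application, the
premises must have disjoint occurrences (`disjoint_occ`), so that sums of contexts become unions of
sets of times; the ancestor lists ensure this. -/

namespace CMultiset

/-! ### Multisets indexed by sets of times -/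

variable {α : Type}

theorem ofFamily_of_isEmpty {ι : Type} [Countable ι] [IsEmpty ι] (a : ι → α) :
    ofFamily a = 0 :=
  (ofFamily_eq_ofFamily_iff _ _).2 ⟨Equiv.equivOfIsEmpty _ _, fun i => isEmptyElim i⟩

theorem ofFamily_restrict_singleton (f : ℕ → α) (k : ℕ) :
    ofFamily (fun j : ({k} : Set ℕ) => f j) = single (f k) :=
  (ofFamily_eq_ofFamily_iff _ _).2 ⟨Equiv.ofUnique _ _, fun i => by rw [Set.mem_singleton_iff.1 i.2]⟩

theorem ofFamily_union_iUnion (f : ℕ → α) {ι : Type} [Countable ι] (A : Set ℕ) (B : ι → Set ℕ)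
    (hAB : ∀ i, Disjoint A (B i)) (hB : Pairwise fun i j => Disjoint (B i) (B j)) :
    ofFamily (fun j : (A ∪ ⋃ i, B i : Set ℕ) => f j) =
      ofFamily (fun j : A => f j) + sum (fun i => ofFamily (fun j : B i => f j)) := by
  rw [sum_ofFamily (fun i (j : B i) => f j), ofFamily_add_ofFamily, eq_comm,
    ofFamily_eq_ofFamily_iff]
  let g : A ⊕ (Σ i, B i) → (A ∪ ⋃ i, B i : Set ℕ) :=
    Sum.elim (fun j => ⟨j, Or.inl j.2⟩) (fun p => ⟨p.2, Or.inr (Set.mem_iUnion.2 ⟨p.1, p.2.2⟩)⟩)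
  refine ⟨Equiv.ofBijective g ⟨?_, ?_⟩, ?_⟩
  · rintro (⟨a, ha⟩ | ⟨i, a, ha⟩) (⟨b, hb⟩ | ⟨j, b, hb⟩) h <;>
      obtain rfl : a = b := congrArg Subtype.val h
    · rfl
    · exact (Set.disjoint_left.1 (hAB j) ha hb).elim
    · exact (Set.disjoint_left.1 (hAB i) hb ha).elim
    · by_cases hij : i = j
      · subst hij; rfl
      · exact (Set.disjoint_left.1 (hB hij) ha hb).elim
  · rintro ⟨j, hj | hj⟩
    · exact ⟨Sum.inl ⟨j, hj⟩, rfl⟩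
    · obtain ⟨i, hi⟩ := Set.mem_iUnion.1 hj
      exact ⟨Sum.inr ⟨i, j, hi⟩, rfl⟩
  · rintro (j | p) <;> rfl

end CMultiset

/-! ### A Krivine machine with timestamps -/

/-- Closures of the machine: a suspended argument together with its environment and the times of
the visits that lead to it in the derivation tree, or an external closure, which stands
for a free variable of the initial term or for an argument supplied from outside. -/
inductive Closure : Type
  | free (x : ℕ) : Closure
  | arg (n : ℕ) : Closure
  | susp (anc : List ℕ) (t : Term) (env : ℕ → Closure) : Closure

/-- States of the machine. The stack is infinite; `anc` lists the times of the visits to the terms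
which surround the current one. -/
structure KState where
  term : Term
  env : ℕ → Closure
  stack : ℕ → Closure
  anc : List ℕ

/-- Push a closure on a stack. -/
def pushStack (c : Closure) (s : ℕ → Closure) : ℕ → Closure
  | 0 => c
  | n + 1 => s n

/-- The transition made at time `k`. The machine stops when it looks up an external closure. -/
def kstep (k : ℕ) : KState → Option KState
  | ⟨.var x, e, s, _⟩ =>
    match e x with
    | .susp a t e' => some ⟨t, e', s, a⟩
    | _ => none
  | ⟨.lam x t, e, s, a⟩ => some ⟨t, Function.update e x (s 0), fun n => s (n + 1), k :: a⟩
  | ⟨.app t u, e, s, a⟩ => some ⟨t, e, pushStack (.susp (k :: a) u e) s, k :: a⟩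

/-- The run of the machine on a term. -/
def krun (t : Term) : ℕ → Option KState
  | 0 => some ⟨t, .free, .arg, []⟩
  | k + 1 => (krun t k).bind (kstep k)

section Run

variable {t₀ : Term}

theorem krun_succ_lam {k x t e s a} (h : krun t₀ k = some ⟨.lam x t, e, s, a⟩) :
    krun t₀ (k + 1) =
      some ⟨t, Function.update e x (s 0), fun n => s (n + 1), k :: a⟩ := by
  simp [krun, h, kstep]

theorem krun_succ_app {k t u e s a} (h : krun t₀ k = some ⟨.app t u, e, s, a⟩) :
    krun t₀ (k + 1) = some ⟨t, e, pushStack (.susp (k :: a) u e) s, k :: a⟩ := by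
  simp [krun, h, kstep]

theorem krun_succ_var {k x e s a a' t e'} (h : krun t₀ k = some ⟨.var x, e, s, a⟩)
    (hc : e x = .susp a' t e') : krun t₀ (k + 1) = some ⟨t, e', s, a'⟩ := by
  simp [krun, h, kstep, hc]

/-- The possible origins of a state. -/
theorem krun_succ_cases {k : ℕ} {q : KState} (h : krun t₀ (k + 1) = some q) :
    (∃ x e s a a' t e', krun t₀ k = some ⟨.var x, e, s, a⟩ ∧ e x = .susp a' t e' ∧
      q = ⟨t, e', s, a'⟩) ∨
    (∃ x t e s a, krun t₀ k = some ⟨.lam x t, e, s, a⟩ ∧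
      q = ⟨t, Function.update e x (s 0), fun n => s (n + 1), k :: a⟩) ∨
    (∃ t u e s a, krun t₀ k = some ⟨.app t u, e, s, a⟩ ∧
      q = ⟨t, e, pushStack (.susp (k :: a) u e) s, k :: a⟩) := by
  obtain ⟨⟨v, e, s, a⟩, hp, hq⟩ := Option.bind_eq_some_iff.1 (show (krun t₀ k).bind (kstep k) = _ from h)
  cases v with
  | var x =>
    rcases hc : e x with y | n | ⟨a', t, e'⟩ <;> simp [kstep, hc] at hq
    exact Or.inl ⟨x, e, s, a, a', t, e', hp, hc, hq.symm⟩
  | lam x t =>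
    simp only [kstep, Option.some.injEq] at hq
    exact Or.inr (Or.inl ⟨x, t, e, s, a, hp, hq.symm⟩)
  | app t u =>
    simp only [kstep, Option.some.injEq] at hq
    exact Or.inr (Or.inr ⟨t, u, e, s, a, hp, hq.symm⟩)

/-! ### Freshness of closures and linearity of the stack -/

variable (t₀) in
/-- The suspended closure `c` has been created before time `k`. -/
def CreatedBefore (k : ℕ) (c : Closure) : Prop :=
  ∀ a u e, c = .susp a u e → ∃ i < k, ∃ t s a', krun t₀ i = some ⟨.app t u, e, s, a'⟩ ∧ a = i :: a'

theorem CreatedBefore.mono {k l : ℕ} (h : k ≤ l) {c : Closure} (hc : CreatedBefore t₀ k c) :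
    CreatedBefore t₀ l c := fun a u e hce => by
  obtain ⟨i, hi, r⟩ := hc a u e hce
  exact ⟨i, hi.trans_le h, r⟩

/-- Strong induction is needed because a lookup restores the environment of an application visited
at an arbitrary earlier time. -/
theorem createdBefore_of_krun (k : ℕ) : ∀ q, krun t₀ k = some q →
    (∀ x, CreatedBefore t₀ k (q.env x)) ∧ ∀ n, CreatedBefore t₀ k (q.stack n) := by
  induction k using Nat.strong_induction_on with
  | _ k ih =>
    intro q hq
    cases k with
    | zero =>
      obtain rfl : _ = q := Option.some.inj hq
      exact ⟨fun x a u e h => by simp at h, fun n a u e h => by simp at h⟩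
    | succ k =>
      rcases krun_succ_cases hq with ⟨x, e, s, a, a', t, e', h, hc, rfl⟩ |
        ⟨x, t, e, s, a, h, rfl⟩ | ⟨t, u, e, s, a, h, rfl⟩
      · have hk := ih k k.lt_succ_self _ h
        obtain ⟨i, hi, t', s', b, hib, rfl⟩ := hk.1 x _ _ _ hc
        exact ⟨fun y => ((ih i (hi.trans k.lt_succ_self) _ hib).1 y).mono (by omega),
          fun n => (hk.2 n).mono k.le_succ⟩
      · have hk := ih k k.lt_succ_self _ h
        refine ⟨fun y => ?_, fun n => (hk.2 (n + 1)).mono k.le_succ⟩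
        by_cases hy : y = x
        · subst hy
          simpa using (hk.2 0).mono k.le_succ
        · simpa [hy] using (hk.1 y).mono k.le_succ
      · have hk := ih k k.lt_succ_self _ h
        refine ⟨fun y => (hk.1 y).mono k.le_succ, fun n => ?_⟩
        cases n with
        | zero =>
          rintro _ _ _ ⟨⟩
          exact ⟨k, k.lt_succ_self, t, s, a, h, rfl⟩
        | succ n => exact (hk.2 n).mono k.le_succ

theorem stack_ne_free (k : ℕ) : ∀ q, krun t₀ k = some q → ∀ n x, q.stack n ≠ .free x := by
  induction k with
  | zero =>
    rintro q hq n x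
    obtain rfl : _ = q := Option.some.inj hq
    simp
  | succ k ih =>
    intro q hq n y
    rcases krun_succ_cases hq with ⟨x, e, s, a, a', t, e', h, hc, rfl⟩ |
      ⟨x, t, e, s, a, h, rfl⟩ | ⟨t, u, e, s, a, h, rfl⟩
    · exact ih _ h n y
    · exact ih _ h (n + 1) y
    · cases n with
      | zero => simp [pushStack]
      | succ n => exact ih _ h n y

variable (t₀) in
/-- At time `k` the closure `c` is taken from the stack and bound to `x` in `t`. -/
def PoppedAt (k x : ℕ) (t : Term) (c : Closure) : Prop :=
  ∃ e s a, krun t₀ k = some ⟨.lam x t, e, s, a⟩ ∧ s 0 = c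

theorem PoppedAt.createdBefore {k x t c} (h : PoppedAt t₀ k x t c) : CreatedBefore t₀ k c := by
  obtain ⟨e, s, a, h, rfl⟩ := h
  exact (createdBefore_of_krun k _ h).2 0

theorem not_createdBefore_susp {k a u e} : ¬ CreatedBefore t₀ k (.susp (k :: a) u e) := by
  intro h
  obtain ⟨i, hi, t, s, a', -, h⟩ := h _ _ _ rfl
  simp at h
  omega

/-- The entries of the stack are distinct, and none of them has been taken from the stack before. -/
theorem stack_injective_and_not_popped (k : ℕ) : ∀ q, krun t₀ k = some q →
    Function.Injective q.stack ∧ ∀ j < k, ∀ x t n, ¬ PoppedAt t₀ j x t (q.stack n) := by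
  induction k with
  | zero =>
    rintro q hq
    obtain rfl : _ = q := Option.some.inj hq
    exact ⟨fun m n h => Closure.arg.inj h, fun j hj => absurd hj (Nat.not_lt_zero j)⟩
  | succ k ih =>
    intro q hq
    rcases krun_succ_cases hq with ⟨x, e, s, a, a', t, e', h, hc, rfl⟩ |
      ⟨x, t, e, s, a, h, rfl⟩ | ⟨t, u, e, s, a, h, rfl⟩
    · refine ⟨(ih _ h).1, fun j hj y t' n hp => ?_⟩
      rcases Nat.lt_succ_iff_lt_or_eq.1 hj with hj | rfl
      · exact (ih _ h).2 j hj y t' n hp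
      · obtain ⟨_, _, _, h', -⟩ := hp
        simp [h] at h'
    · refine ⟨fun m n hmn => Nat.succ_injective ((ih _ h).1 hmn), fun j hj y t' n hp => ?_⟩
      rcases Nat.lt_succ_iff_lt_or_eq.1 hj with hj | rfl
      · exact (ih _ h).2 j hj y t' (n + 1) hp
      · obtain ⟨_, s', _, h', h0⟩ := hp
        simp only [h, Option.some.injEq, KState.mk.injEq] at h'
        obtain ⟨-, -, rfl, -⟩ := h'
        exact Nat.succ_ne_zero n ((ih _ h).1 h0).symm
    · have hne : ∀ n, s n ≠ .susp (k :: a) u e := fun n hn =>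
        not_createdBefore_susp (t₀ := t₀) (by
          rw [← hn]
          exact (createdBefore_of_krun k _ h).2 n)
      refine ⟨fun m n hmn => ?_, fun j hj y t' n hp => ?_⟩
      · cases m <;> cases n
        · rfl
        · exact (hne _ hmn.symm).elim
        · exact (hne _ hmn).elim
        · exact congrArg Nat.succ ((ih _ h).1 hmn)
      · rcases Nat.lt_succ_iff_lt_or_eq.1 hj with hj | rfl
        · cases n with
          | zero => exact not_createdBefore_susp (hp.createdBefore.mono hj.le)
          | succ n => exact (ih _ h).2 j hj y t' n hp
        · obtain ⟨_, _, _, h', -⟩ := hp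
          simp [h] at h'

theorem PoppedAt.time_unique {k l x y t u c} (h : PoppedAt t₀ k x t c) (h' : PoppedAt t₀ l y u c) :
    k = l := by
  have key : ∀ {k l x y t u}, PoppedAt t₀ k x t c → PoppedAt t₀ l y u c → ¬ k < l := by
    rintro k l x y t u hk ⟨e, s, a, hl, rfl⟩ hkl
    exact (stack_injective_and_not_popped l _ hl).2 k hkl x t 0 hk
  exact le_antisymm (not_lt.1 (key h' h)) (not_lt.1 (key h h'))

/-! ### Occurrences of variables in the derivation extracted from a run -/

variable (t₀) in
/-- The times at which the closure `c` is looked up. -/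
def lookups (c : Closure) : Set ℕ := {j | ∃ x e s a, krun t₀ j = some ⟨.var x, e, s, a⟩ ∧ e x = c}

variable (t₀) in
/-- The ancestors of the visit at time `k`. -/
def ancAt (k : ℕ) : List ℕ := (krun t₀ k).elim [] KState.anc

variable (t₀) in
/-- The environment at time `k`. -/
def envAt (k : ℕ) : ℕ → Closure := (krun t₀ k).elim .free KState.env

variable (t₀) in
/-- The stack at time `k`. -/
def stackAt (k : ℕ) : ℕ → Closure := (krun t₀ k).elim .arg KState.stack

variable (t₀) in
/-- The times of the visits to free occurrences of `x` in the derivation for the term `u` visited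
at time `k`. -/
def occ : Term → ℕ → ℕ → Set ℕ
  | .var y, k, x => if x = y then {k} else ∅
  | .lam y t, k, x => if x = y then ∅ else occ t (k + 1) x
  | .app t u, k, x => occ t (k + 1) x ∪
      ⋃ j : lookups t₀ (.susp (k :: ancAt t₀ k) u (envAt t₀ k)), occ u (j + 1) x

-- A lookup leaves the stack unchanged, so the argument visited at `j + 1` receives the type that
-- the lookup at `j` contributes to the source.
variable (t₀) in
theorem krun_succ_lookups {j a t e} (h : j ∈ lookups t₀ (.susp a t e)) :
    krun t₀ (j + 1) = some ⟨t, e, stackAt t₀ j, a⟩ := by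
  obtain ⟨x, e', s, a', h, hc⟩ := h
  simpa [stackAt, h] using krun_succ_var h hc

/-- Premises inherit the environment on free variables, even when an argument is resumed much later,
and their ancestor lists extend that of the conclusion. -/
theorem mem_occ (u : Term) : ∀ {k e s a x j}, krun t₀ k = some ⟨u, e, s, a⟩ → j ∈ occ t₀ u k x →
    j ∈ lookups t₀ (e x) ∧ k :: a <:+ j :: ancAt t₀ j := by
  induction u with
  | var y =>
    intro k e s a x j h hj
    rw [occ] at hj
    split_ifs at hj with hx
    · obtain rfl := hx
      obtain rfl : j = k := hj
      exact ⟨⟨x, e, s, a, h, rfl⟩, by simp [ancAt, h]⟩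
    · exact hj.elim
  | lam y t ih =>
    intro k e s a x j h hj
    rw [occ] at hj
    split_ifs at hj with hx
    · exact hj.elim
    · obtain ⟨h1, h2⟩ := ih (krun_succ_lam h) hj
      rw [Function.update_of_ne hx] at h1
      exact ⟨h1, (List.suffix_cons _ _).trans h2⟩
  | app t u iht ihu =>
    intro k e s a x j h hj
    rcases hj with hj | hj
    · obtain ⟨h1, h2⟩ := iht (krun_succ_app h) hj
      exact ⟨h1, (List.suffix_cons _ _).trans h2⟩
    · obtain ⟨i, hi⟩ := Set.mem_iUnion.1 hj
      obtain ⟨h1, h2⟩ := ihu (krun_succ_lookups t₀ i.2) hi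
      simp only [envAt, ancAt, h, Option.elim_some] at h1 h2
      exact ⟨h1, (List.suffix_cons _ _).trans h2⟩

/-- Distinct visits with the same ancestors contain no common occurrence. -/
theorem disjoint_occ {t u k l e e' s s' a x} (hk : krun t₀ k = some ⟨t, e, s, a⟩)
    (hl : krun t₀ l = some ⟨u, e', s', a⟩) (hkl : k ≠ l) :
    Disjoint (occ t₀ t k x) (occ t₀ u l x) := by
  refine Set.disjoint_left.2 fun j h h' => hkl ?_
  -- `k :: a` and `l :: a` are suffixes of one list and have the same length, hence coincide.
  have := List.suffix_of_suffix_length_le (mem_occ t hk h).2 (mem_occ u hl h').2 (by simp)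
  exact (List.cons.inj (this.eq_of_length (by simp))).1

/-- A closure bound to `x` by a visit to `λx.t` is looked up only in the derivation for `t`. -/
theorem occ_subset_of_poppedAt {k x t c} (hp : PoppedAt t₀ k x t c) (j : ℕ) :
    ∀ {u e s a y}, krun t₀ j = some ⟨u, e, s, a⟩ → e y = c →
      y = x ∧ occ t₀ u j x ⊆ occ t₀ t (k + 1) x := by
  induction j using Nat.strong_induction_on with
  | _ j ih =>
    intro v e s a y hj hy
    cases j with
    | zero =>
      obtain ⟨_, s', _, h', h0⟩ := hp
      simp only [krun, Option.some.injEq, KState.mk.injEq] at hj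
      obtain ⟨-, rfl, -, -⟩ := hj
      -- The initial environment holds only `free` closures, which never enter a stack.
      exact (stack_ne_free k _ h' 0 y (h0.trans hy.symm)).elim
    | succ j =>
      rcases krun_succ_cases hj with ⟨z, e₁, s₁, a₁, a', u, e', h, hc, hq⟩ |
        ⟨z, u, e₁, s₁, a₁, h, hq⟩ | ⟨u, w, e₁, s₁, a₁, h, hq⟩ <;> cases hq
      · obtain ⟨i, hi, t', s', b, hib, rfl⟩ := (createdBefore_of_krun j _ h).1 z _ _ _ hc
        obtain ⟨rfl, hs⟩ := ih i (by omega) hib hy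
        refine ⟨rfl, subset_trans (fun l hl => ?_) hs⟩
        refine Or.inr (Set.mem_iUnion.2 ⟨⟨j, ?_⟩, hl⟩)
        simp only [envAt, ancAt, hib, Option.elim_some]
        exact ⟨z, _, _, _, h, hc⟩
      · by_cases hyz : y = z
        · subst hyz
          rw [Function.update_self] at hy
          -- The closure is bound here, and it is popped only once, so this is the visit at time
          -- `k`.
          obtain rfl := hp.time_unique ⟨_, _, _, h, hy⟩
          obtain ⟨_, _, _, h', -⟩ := hp
          rw [h] at h'
          cases h'
          exact ⟨rfl, subset_rfl⟩
        · rw [Function.update_of_ne hyz] at hy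
          obtain ⟨rfl, hs⟩ := ih j j.lt_succ_self h hy
          rw [occ, if_neg hyz] at hs
          exact ⟨rfl, hs⟩
      · obtain ⟨rfl, hs⟩ := ih j j.lt_succ_self h hy
        exact ⟨rfl, subset_trans Set.subset_union_left hs⟩

theorem occ_eq_lookups {k x t e s a} (h : krun t₀ k = some ⟨.lam x t, e, s, a⟩) :
    occ t₀ t (k + 1) x = lookups t₀ (s 0) := by
  ext j
  constructor
  · intro hj
    simpa using (mem_occ t (krun_succ_lam h) hj).1
  · rintro ⟨y, e', s', a', hj, hy⟩
    obtain ⟨rfl, hs⟩ := occ_subset_of_poppedAt ⟨_, _, _, h, rfl⟩ j hj hy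
    exact hs (by simp [occ])

end Run

/-! ### Types of stacks -/

variable (O : Type) (t₀ : Term)

/-- The type of the terms visited with stack `s`: its sources are the entries of the stack, each
presented by the types of its uses. -/
noncomputable def stackType (s : ℕ → Closure) : RType O :=
  QPF.Cofix.corec (F := RTypeF O) (fun s : ℕ → Closure =>
    (Sum.inr (CMultiset.ofFamily fun j : lookups t₀ (s 0) => stackAt t₀ j, fun n => s (n + 1)) :
      RTypeF O (ℕ → Closure))) s

theorem stackType_eq (s : ℕ → Closure) :
    stackType O t₀ s =
      RType.arrow (CMultiset.ofFamily fun j : lookups t₀ (s 0) => stackType O t₀ (stackAt t₀ j))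
        (stackType O t₀ fun n => s (n + 1)) := by
  rw [← RType.mk_dest (stackType O t₀ s), RType.arrow]
  congr 1
  exact QPF.Cofix.dest_corec _ _

/-- The multiset of types of the variable visits at the times in `A`. -/
noncomputable def typesAt (A : Set ℕ) : CMultiset (RType O) :=
  CMultiset.ofFamily fun j : A => stackType O t₀ (stackAt t₀ j)

theorem typesAt_empty : typesAt O t₀ ∅ = 0 := CMultiset.ofFamily_of_isEmpty _

variable {O t₀} in
theorem RDerivable.congr_context {Γ Δ : RContext O} {t : Term} {τ : RType O}
    (h : RDerivable Γ t τ) (hΓ : ∀ x, Δ x = Γ x) : RDerivable Δ t τ := by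
  obtain rfl : Δ = Γ := funext hΓ
  exact h

/-- The derivation extracted from the run. -/
theorem derivable_of_krun (u : Term) : ∀ {k e s a}, krun t₀ k = some ⟨u, e, s, a⟩ →
    RDerivable (fun x => typesAt O t₀ (occ t₀ u k x)) u (stackType O t₀ s) := by
  induction u with
  | var y =>
    intro k e s a h
    refine (RDerivable.ax y (stackType O t₀ s)).congr_context fun x => ?_
    by_cases hx : x = y
    · subst hx
      rw [occ, if_pos rfl, RContext.single, Function.update_self, typesAt,
        CMultiset.ofFamily_restrict_singleton (fun j => stackType O t₀ (stackAt t₀ j))]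
      simp [stackAt, h]
    · rw [occ, if_neg hx, RContext.single, Function.update_of_ne hx, typesAt_empty]
  | lam y t ih =>
    intro k e s a h
    rw [stackType_eq]
    refine RDerivable.abs _ y _ t _ (by simp [occ, typesAt_empty]) ?_
    refine (ih (krun_succ_lam h)).congr_context fun x => ?_
    by_cases hx : x = y
    · subst hx
      rw [Function.update_self, occ_eq_lookups h, typesAt]
    · rw [Function.update_of_ne hx, occ, if_neg hx]
  | app t u iht ihu =>
    intro k e s a h
    obtain rfl : ancAt t₀ k = a := by simp [ancAt, h]
    obtain rfl : envAt t₀ k = e := by simp [envAt, h]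
    have ht := iht (krun_succ_app h)
    rw [stackType_eq] at ht
    have hu := fun j : lookups t₀ (.susp (k :: ancAt t₀ k) u (envAt t₀ k)) => ihu (krun_succ_lookups t₀ j.2)
    refine (RDerivable.app _ _ t u _ _ ht hu).congr_context fun x => ?_
    -- All premises were visited with the same ancestors `k :: ancAt t₀ k`; only the distinctness of
    -- their times is left to check.
    refine CMultiset.ofFamily_union_iUnion (fun j => stackType O t₀ (stackAt t₀ j)) _ _ ?_ ?_
    · rintro ⟨j, hj⟩
      refine disjoint_occ (krun_succ_app h) (krun_succ_lookups t₀ hj) ?_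
      rintro hkj
      obtain rfl := Nat.succ_injective hkj
      obtain ⟨_, _, _, _, h', -⟩ := hj
      simp [h] at h'
    · intro i j hij
      exact disjoint_occ (krun_succ_lookups t₀ i.2) (krun_succ_lookups t₀ j.2)
        fun hs => hij (Subtype.ext (Nat.succ_injective hs))

theorem mainTheorem1 (O : Type) [Nonempty O] (t : Term) :
    RTypable O t ∧ (denotation O t).Nonempty :=
  have h := derivable_of_krun O t t (k := 0) rfl
  ⟨⟨_, _, h⟩, ⟨(_, _), h⟩⟩
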